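/- For $A \in \mathrm{SL}(2,\mathbb{Z})$ let $f_A$ be the self-homeomorphism of the torus $S = (\mathbb{R}/\mathbb{Z})^2$ induced by the linear map $v \mapsto Av$, and let $$M(A) = S \times [0,1] / \big((x,0) \sim (f_A(x),1)\big)$$ be its mapping torus. For a finite group $G$ let $$Z(M(A), G) = \frac{|\mathrm{Hom}(\pi_1(M(A)), G)|}{|G|}$$ be the untwisted Dijkgraaf–Witten invariant (for any base point). In $\mathrm{SL}(2,\mathbb{Z}/2)$ put $T = \begin{pmatrix} 1 & 1 \\ 0 & 1\end{pmatrix}$ and $S_0 = \begin{pmatrix} 0 & 1 \\ -1 & 0\end{pmatrix}$, and let $\mathcal{C}1 = \{\mathrm{Id}\}$ and $\mathcal{C}2 = \{T, S_0, T S_0 T\}$ (the conjugacy class of the elements of order $2$). Let $[A]$ be a conjugacy class in $\mathrm{SL}(2,\mathbb{Z})$, and let $[A] \bmod 2$ be the conjugacy class in $\mathrm{SL}(2,\mathbb{Z}/2)$ of the reduction mod $2$ of its elements. Then, for every representative $A$ of $[A]$, the number $Z(M([A]), \mathbb{Z}/2) := Z(M(A), \mathbb{Z}/2)$ is $$Z(M([A]),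 \mathbb{Z}/2) = \begin{cases} 4 & \text{if } [A] \bmod 2 \text{ is } \mathcal{C}1, \\ 2 & \text{if } [A] \bmod 2 \text{ is } \mathcal{C}2, \\ 1 & \text{otherwise.} \end{cases}$$ -/

import Mathlib

open scoped MatrixGroups

noncomputable section

namespace DijkgraafWitten

/-- The untwisted Dijkgraaf-Witten invariant `|Hom(π₁(M, x₀), G)| / |G|` of a space `M` with base
point `x₀`, for a finite gauge group `G`. -/
def untwistedInvariant (M : Type*) [TopologicalSpace M] (x₀ : M) (G : Type*) [Group G] : ℚ :=
  (Nat.card (FundamentalGroup M x₀ →* G) : ℚ) / (Nat.card G : ℚ)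

/-- The relation `(x, 0) ∼ (f x, 1)` on `X × [0, 1]`. -/
def GluingRel {X : Type*} [TopologicalSpace X] (f : X ≃ₜ X) (p q : X × unitInterval) : Prop :=
  p.2 = 0 ∧ q.2 = 1 ∧ q.1 = f p.1

/-- The mapping torus of `f`: the quotient of `X × [0, 1]` by the equivalence relation generated by
`(x, 0) ∼ (f x, 1)`, with the quotient topology. -/
def MappingTorus {X : Type*} [TopologicalSpace X] (f : X ≃ₜ X) : Type _ :=
  Quot (GluingRel f)

instance {X : Type*} [TopologicalSpace X] (f : X ≃ₜ X) : TopologicalSpace (MappingTorus f) :=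
  inferInstanceAs (TopologicalSpace (Quot (GluingRel f)))

/-- The closed surface of genus one, `(ℝ / ℤ)²`. -/
abbrev Torus : Type := Fin 2 → UnitAddCircle

/-- The self-map of `(ℝ / ℤ)²` induced by the linear map `v ↦ A v` of `ℝ²`. -/
def torusMap (A : SL(2, ℤ)) (x : Torus) : Torus :=
  fun i => ∑ j, A.1 i j • x j

theorem torusMap_mul (A B : SL(2, ℤ)) (x : Torus) :
    torusMap A (torusMap B x) = torusMap (A * B) x := by
  funext i
  simp [torusMap, Matrix.mul_apply, Fin.sum_univ_two, smul_add, add_smul, smul_smul]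
  abel

theorem torusMap_one (x : Torus) : torusMap 1 x = x := by
  funext i
  fin_cases i <;> simp [torusMap, Fin.sum_univ_two]

theorem continuous_torusMap (A : SL(2, ℤ)) : Continuous (torusMap A) := by
  unfold torusMap
  fun_prop

/-- The homeomorphism of `(ℝ / ℤ)²` induced by `A`; its isotopy class is the element of the mapping
class group of the torus that corresponds to `A`. -/
def torusHomeomorph (A : SL(2, ℤ)) : Torus ≃ₜ Torus where
  toFun := torusMap A
  invFun := torusMap A⁻¹
  left_inv x := by rw [torusMap_mul, inv_mul_cancel, torusMap_one]
  right_inv x := by rw [torusMap_mul, mul_inv_cancel, torusMap_one]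
  continuous_toFun := continuous_torusMap A
  continuous_invFun := continuous_torusMap A⁻¹

/-- The mapping torus `M(A)` of genus one. -/
abbrev torusBundle (A : SL(2, ℤ)) : Type := MappingTorus (torusHomeomorph A)

/-- Reduction modulo two. -/
def reduction : SL(2, ℤ) →* SL(2, ZMod 2) :=
  Matrix.SpecialLinearGroup.map (Int.castRingHom (ZMod 2))

def matT : SL(2, ZMod 2) := ⟨!![1, 1; 0, 1], by decide⟩

def matS : SL(2, ZMod 2) := ⟨!![0, 1; -1, 0], by decide⟩

/-- The identity class of `SL(2, ℤ/2)`. -/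
def classC1 : Set SL(2, ZMod 2) := {1}

/-- The class `{T, S, TST}` of `SL(2, ℤ/2)`, which consists of the elements of order two. -/
def classC2 : Set SL(2, ZMod 2) := {matT, matS, matT * matS * matT}

theorem mem_classC2_iff (g : SL(2, ZMod 2)) : g ∈ classC2 ↔ orderOf g = 2 := by
  rw [orderOf_eq_prime_iff]
  simp only [classC2, Set.mem_insert_iff, Set.mem_singleton_iff]
  revert g
  decide

end DijkgraafWitten

end

noncomputable section

namespace DijkgraafWitten

open Topology

/-! The space `ℝ² × ℝ` is the universal cover of `M(A)`, with deck group `ℤ² ⋊ ℤ` acting by `(w, n)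
• (v, t) = (w + Aⁿ v, n + t)` (`isQuotientCoveringMap_bundleCover`). So `π₁(M(A))` is this group up
to passing to the opposite, which a commutative target does not see. A homomorphism to `ℤ/2` is a
free choice of value on the generator of `ℤ` together with an `A`-invariant functional on `ℤ²`, that
is, a row vector `u` mod 2 with `u A = u` (`card_hom`). Dividing by `|ℤ/2|` removes the free choice,
and the invariant is the number of such `u`: 4 for the identity, 2 for an involution, 1 for an
element of order three (`card_fixed_vecMul`). -/

/-- The group `ℤ² ⋊ ℤ`, in which the generator of `ℤ` acts on `ℤ²` by `A`. -/
@[ext] structure BundleGroup (A : SL(2, ℤ)) where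
  vec : Fin 2 → ℤ
  shift : ℤ

/-! ### The group `ℤ² ⋊ ℤ` and its homomorphisms to `ℤ/2` -/

namespace BundleGroup

variable {A : SL(2, ℤ)}

instance : Mul (BundleGroup A) :=
  ⟨fun g h => ⟨g.vec + (A ^ g.shift).1.mulVec h.vec, g.shift + h.shift⟩⟩
instance : One (BundleGroup A) := ⟨⟨0, 0⟩⟩
instance : Inv (BundleGroup A) := ⟨fun g => ⟨-(A ^ (-g.shift)).1.mulVec g.vec, -g.shift⟩⟩

@[simp] theorem mul_vec (g h : BundleGroup A) :
    (g * h).vec = g.vec + (A ^ g.shift).1.mulVec h.vec := rfl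
@[simp] theorem mul_shift (g h : BundleGroup A) : (g * h).shift = g.shift + h.shift := rfl
@[simp] theorem one_vec : (1 : BundleGroup A).vec = 0 := rfl
@[simp] theorem one_shift : (1 : BundleGroup A).shift = 0 := rfl
@[simp] theorem inv_vec (g : BundleGroup A) :
    g⁻¹.vec = -(A ^ (-g.shift)).1.mulVec g.vec := rfl
@[simp] theorem inv_shift (g : BundleGroup A) : g⁻¹.shift = -g.shift := rfl

instance : Group (BundleGroup A) :=
  Group.ofLeftAxioms
    (fun a b c => by
      ext1
      · rw [mul_vec, mul_vec, mul_vec, mul_vec, mul_shift, zpow_add, Matrix.mulVec_add,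
          Matrix.mulVec_mulVec, Matrix.SpecialLinearGroup.coe_mul, add_assoc]
      · simp [add_assoc])
    (fun a => by ext1 <;> simp)
    (fun a => by ext1 <;> simp)

variable (A) in
/-- The generator of the factor `ℤ` of `ℤ² ⋊ ℤ`. -/
def stableLetter : BundleGroup A := ⟨0, 1⟩

variable (A) in
/-- The inclusion of `ℤ²` into `ℤ² ⋊ ℤ`. -/
def ofVec : Multiplicative (Fin 2 → ℤ) →* BundleGroup A where
  toFun w := ⟨w.toAdd, 0⟩
  map_one' := rfl
  map_mul' v w := by ext1 <;> simp

theorem stableLetter_zpow (n : ℤ) : stableLetter A ^ n = ⟨0, n⟩ := by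
  induction n using Int.induction_on with
  | zero => rfl
  | succ k ih => rw [zpow_add_one, ih]; ext1 <;> simp [stableLetter]
  | pred k ih =>
    rw [zpow_sub_one, ih]
    ext1
    · simp [stableLetter]
    · simp [stableLetter, sub_eq_add_neg]

theorem eq_ofVec_mul_zpow (g : BundleGroup A) :
    g = ofVec A (.ofAdd g.vec) * stableLetter A ^ g.shift := by
  rw [stableLetter_zpow]
  ext1 <;> simp [ofVec]

theorem stableLetter_mul_ofVec (w : Fin 2 → ℤ) :
    stableLetter A * ofVec A (.ofAdd w) = ofVec A (.ofAdd (A.1.mulVec w)) * stableLetter A := by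
  ext1 <;> simp [ofVec, stableLetter]

theorem vecMul_reduction_zpow {u : Fin 2 → ZMod 2}
    (hu : Matrix.vecMul u (reduction A).1 = u) (n : ℤ) :
    Matrix.vecMul u (reduction (A ^ n)).1 = u := by
  -- The stabilizer of `u` is a subgroup, which covers negative powers too.
  let H : Subgroup SL(2, ZMod 2) :=
    { carrier := {B | Matrix.vecMul u B.1 = u}
      one_mem' := by simp
      mul_mem' := fun {B C} hB hC => by
        simp only [Set.mem_ofPred_eq] at hB hC ⊢
        rw [Matrix.SpecialLinearGroup.coe_mul, ← Matrix.vecMul_vecMul, hB, hC]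
      inv_mem' := fun {B} hB => by
        simp only [Set.mem_ofPred_eq] at hB ⊢
        conv_lhs => rw [← hB]
        rw [Matrix.vecMul_vecMul, ← Matrix.SpecialLinearGroup.coe_mul, mul_inv_cancel]
        simp }
  have : reduction A ^ n ∈ H := H.zpow_mem hu n
  rwa [map_zpow]

theorem cast_mulVec (B : SL(2, ℤ)) (w : Fin 2 → ℤ) :
    (fun i => (B.1.mulVec w i : ZMod 2)) = (reduction B).1.mulVec (fun i => (w i : ZMod 2)) := by
  funext i
  simp [Matrix.mulVec, dotProduct, reduction]

/-- The homomorphism `(w, n) ↦ u ⬝ w + s n` to `ℤ/2`, for `u` fixed by the transpose of `A`. -/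
def character (u : {u : Fin 2 → ZMod 2 // Matrix.vecMul u (reduction A).1 = u}) (s : ZMod 2) :
    BundleGroup A →* Multiplicative (ZMod 2) where
  toFun g := .ofAdd (u.1 ⬝ᵥ (fun i => (g.vec i : ZMod 2)) + s * g.shift)
  map_one' := by simp [dotProduct]
  map_mul' g h := by
    rw [← ofAdd_add]
    congr 1
    have : (fun i => ((g * h).vec i : ZMod 2)) = (fun i => (g.vec i : ZMod 2)) +
        (reduction (A ^ g.shift)).1.mulVec (fun i => (h.vec i : ZMod 2)) := by
      rw [← cast_mulVec]; funext i; simp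
    rw [this, dotProduct_add, Matrix.dotProduct_mulVec, vecMul_reduction_zpow u.2]
    simp
    ring

theorem character_injective :
    Function.Injective (fun q : {u : Fin 2 → ZMod 2 // Matrix.vecMul u (reduction A).1 = u} ×
      ZMod 2 => character (A := A) q.1 q.2) := by
  rintro ⟨⟨u, hu⟩, s⟩ ⟨⟨v, hv⟩, t⟩ h
  have hw := fun w n => congrArg Multiplicative.toAdd (DFunLike.congr_fun h ⟨w, n⟩)
  simp only [character, MonoidHom.coe_mk, OneHom.coe_mk, toAdd_ofAdd] at hw
  have h0 := hw ![1, 0] 0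
  have h1 := hw ![0, 1] 0
  have h2 := hw 0 1
  simp [dotProduct, Fin.sum_univ_two] at h0 h1 h2
  refine Prod.ext (Subtype.ext ?_) h2
  funext i
  fin_cases i <;> assumption

/-- The group is generated by `ℤ²` and the stable letter. In a commutative target the relation
`stableLetter_mul_ofVec` says exactly that the restriction to `ℤ²` is `A`-invariant. -/
theorem character_surjective :
    Function.Surjective (fun q : {u : Fin 2 → ZMod 2 // Matrix.vecMul u (reduction A).1 = u} ×
      ZMod 2 => character (A := A) q.1 q.2) := by
  intro f
  let g : (Fin 2 → ℤ) →+ ZMod 2 := AddMonoidHom.toMultiplicative.symm (f.comp (ofVec A))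
  let u : Fin 2 → ZMod 2 := fun i => g (Pi.single i 1)
  have hg (w : Fin 2 → ℤ) : g w = u ⬝ᵥ (fun i => (w i : ZMod 2)) := by
    have : w = w 0 • Pi.single 0 1 + w 1 • Pi.single 1 1 := by
      funext i; fin_cases i <;> simp
    conv_lhs => rw [this]
    rw [map_add, map_zsmul, map_zsmul]
    simp [dotProduct, Fin.sum_univ_two, u, mul_comm]
  have hinv (w : Fin 2 → ℤ) : g (A.1.mulVec w) = g w := by
    have := congrArg f (stableLetter_mul_ofVec (A := A) w)
    rw [map_mul, map_mul, mul_comm] at this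
    exact (mul_right_cancel this).symm
  have hu : Matrix.vecMul u (reduction A).1 = u := by
    funext i
    have h := hinv (Pi.single i 1)
    rw [hg, cast_mulVec, Matrix.dotProduct_mulVec, hg] at h
    have hs : (fun j => ((Pi.single i 1 : Fin 2 → ℤ) j : ZMod 2)) = Pi.single i 1 := by
      funext j; by_cases hj : j = i <;> simp [hj]
    rw [hs] at h
    simpa using h
  refine ⟨(⟨u, hu⟩, (f (stableLetter A)).toAdd), ?_⟩
  ext x
  have hx := congrArg f (eq_ofVec_mul_zpow x)
  rw [map_mul, map_zpow] at hx
  rw [hx]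
  have : f (ofVec A (.ofAdd x.vec)) = .ofAdd (g x.vec) := rfl
  rw [this, hg]
  apply Multiplicative.toAdd.injective
  simp [character, mul_comm]

theorem card_hom (A : SL(2, ℤ)) :
    Nat.card (BundleGroup A →* Multiplicative (ZMod 2)) =
      Nat.card {u : Fin 2 → ZMod 2 // Matrix.vecMul u (reduction A).1 = u} * 2 := by
  rw [← Nat.card_congr (Equiv.ofBijective _ ⟨character_injective (A := A), character_surjective⟩),
    Nat.card_prod]
  simp

end BundleGroup

/-! ### Fixed vectors and conjugacy classes mod 2 -/

theorem card_fixed_vecMul (B : SL(2, ZMod 2)) :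
    (B ∈ classC1 → Nat.card {u : Fin 2 → ZMod 2 // Matrix.vecMul u B.1 = u} = 4) ∧
    (B ∈ classC2 → Nat.card {u : Fin 2 → ZMod 2 // Matrix.vecMul u B.1 = u} = 2) ∧
    (B ∉ classC1 → B ∉ classC2 →
      Nat.card {u : Fin 2 → ZMod 2 // Matrix.vecMul u B.1 = u} = 1) := by
  simp only [Nat.card_eq_fintype_card, classC1, classC2, Set.mem_insert_iff,
    Set.mem_singleton_iff]
  revert B
  decide

theorem classC1_eq_carrier : classC1 = (ConjClasses.mk (1 : SL(2, ZMod 2))).carrier := by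
  ext g
  simp only [classC1, Set.mem_singleton_iff, ConjClasses.mem_carrier_iff_mk_eq,
    ConjClasses.mk_eq_mk_iff_isConj, isConj_one_left]

theorem classC2_eq_carrier : classC2 = (ConjClasses.mk matT).carrier := by
  ext g
  simp only [classC2, Set.mem_insert_iff, Set.mem_singleton_iff, ConjClasses.mem_carrier_iff_mk_eq,
    ConjClasses.mk_eq_mk_iff_isConj, isConj_iff]
  revert g
  decide

/-- Conjugacy classes are disjoint or equal, so one known element decides equality. -/
theorem carrier_eq_iff_mem {G : Type*} [Monoid G] {c : ConjClasses G} {g : G} (hg : g ∈ c.carrier)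
    (d : ConjClasses G) : c.carrier = d.carrier ↔ g ∈ d.carrier := by
  rw [ConjClasses.mem_carrier_iff_mk_eq] at hg ⊢
  subst hg
  exact ⟨fun h => ConjClasses.mem_carrier_iff_mk_eq.1 (h ▸ ConjClasses.mem_carrier_mk),
    fun h => h ▸ rfl⟩

/-! ### The covering of the torus bundle by `ℝ² × ℝ` -/

/-- The projection `ℝ² → (ℝ / ℤ)²`. -/
def torusProj (v : Fin 2 → ℝ) : Torus := fun i => (v i : UnitAddCircle)

theorem isOpenQuotientMap_torusProj : IsOpenQuotientMap torusProj :=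
  IsOpenQuotientMap.piMap fun _ => QuotientAddGroup.isOpenQuotientMap_mk

theorem continuous_torusProj : Continuous torusProj := isOpenQuotientMap_torusProj.continuous

theorem torusProj_eq_iff {v w : Fin 2 → ℝ} :
    torusProj v = torusProj w ↔ ∃ z : Fin 2 → ℤ, v = (fun i => (z i : ℝ)) + w := by
  have h (x y : ℝ) : (x : UnitAddCircle) = y ↔ ∃ z : ℤ, x = z + y := by
    rw [← sub_eq_zero, ← AddCircle.coe_sub, AddCircle.coe_eq_zero_iff]
    simp [sub_eq_iff_eq_add, eq_comm (b := x - y)]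
  simp only [torusProj, funext_iff, h, Pi.add_apply]
  exact Classical.skolem

/-- The linear action of `SL(2, ℤ)` on `ℝ²`. -/
def realMulVec (B : SL(2, ℤ)) (v : Fin 2 → ℝ) : Fin 2 → ℝ :=
  (B.1.map (Int.cast : ℤ → ℝ)).mulVec v

theorem continuous_realMulVec (B : SL(2, ℤ)) : Continuous (realMulVec B) :=
  continuous_const.matrix_mulVec continuous_id

@[simp] theorem realMulVec_one (v : Fin 2 → ℝ) : realMulVec 1 v = v := by
  simp [realMulVec]

theorem realMulVec_mul (B C : SL(2, ℤ)) (v : Fin 2 → ℝ) :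
    realMulVec (B * C) v = realMulVec B (realMulVec C v) := by
  rw [realMulVec, realMulVec, realMulVec, Matrix.mulVec_mulVec, Matrix.SpecialLinearGroup.coe_mul]
  congr 1
  exact Matrix.map_mul (f := Int.castRingHom ℝ)

theorem realMulVec_add (B : SL(2, ℤ)) (v w : Fin 2 → ℝ) :
    realMulVec B (v + w) = realMulVec B v + realMulVec B w :=
  Matrix.mulVec_add _ _ _

theorem realMulVec_intCast (B : SL(2, ℤ)) (z : Fin 2 → ℤ) :
    realMulVec B (fun i => (z i : ℝ)) = fun i => (B.1.mulVec z i : ℝ) := by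
  funext i
  simp [realMulVec, Matrix.mulVec, dotProduct]

theorem torusMap_torusProj (B : SL(2, ℤ)) (v : Fin 2 → ℝ) :
    torusMap B (torusProj v) = torusProj (realMulVec B v) := by
  funext i
  simp [torusMap, torusProj, realMulVec, Matrix.mulVec, dotProduct, Fin.sum_univ_two,
    ← zsmul_eq_mul]

namespace MappingTorus

variable {X : Type*} [TopologicalSpace X] (f : X ≃ₜ X)

/-- The quotient map `X × [0, 1] → M(f)`. -/
def mk (x : X × unitInterval) : MappingTorus f := Quot.mk _ x

theorem isQuotientMap_mk : IsQuotientMap (mk f) := isQuotientMap_quot_mk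

theorem mk_zero (x : X) : mk f (x, 0) = mk f (f x, 1) := Quot.sound ⟨rfl, rfl, rfl⟩

/-- Every point of the mapping torus has a unique representative of height less than one. -/
theorem mk_injOn : Set.InjOn (mk f) {x | x.2 ≠ 1} := by
  classical
  -- A retraction onto heights below one: the top is moved to the bottom by the inverse of `f`, as
  -- the gluing requires.
  let r : MappingTorus f → X × unitInterval :=
    Quot.lift (fun x => if x.2 = 1 then (f.symm x.1, 0) else x) (by
      rintro ⟨x, s⟩ ⟨y, t⟩ ⟨h0, h1, h2⟩
      dsimp only at h0 h1 h2
      subst h0 h1 h2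
      simp)
  have hr (x : X × unitInterval) (hx : x.2 ≠ 1) : r (mk f x) = x := if_neg hx
  intro x hx y hy h
  rw [← hr x hx, ← hr y hy, h]

end MappingTorus

/-- The fractional part of a real number, as a point of the unit interval. -/
def unitFract (t : ℝ) : unitInterval := ⟨Int.fract t, Int.fract_nonneg t, (Int.fract_lt_one t).le⟩

theorem unitFract_ne_one (t : ℝ) : unitFract t ≠ 1 :=
  fun h => (Int.fract_lt_one t).ne (congrArg Subtype.val h)

theorem unitFract_inj {s t : ℝ} : unitFract s = unitFract t ↔ Int.fract s = Int.fract t :=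
  Subtype.ext_iff

@[simp] theorem torusHomeomorph_apply (A : SL(2, ℤ)) (x : Torus) :
    torusHomeomorph A x = torusMap A x := rfl

/-- The map `(v, t) ↦ [A ^ (-⌊t⌋) v, t - ⌊t⌋]` from `ℝ² × ℝ` to the torus bundle. -/
def bundleCover (A : SL(2, ℤ)) (e : (Fin 2 → ℝ) × ℝ) : torusBundle A :=
  MappingTorus.mk _ (torusProj (realMulVec (A ^ (-⌊e.2⌋)) e.1), unitFract e.2)

/-- The floor may be frozen at `n` on the whole closed slab: at the top it jumps by one, and the
gluing absorbs the extra factor `A⁻¹`. -/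
theorem bundleCover_eq_of_mem_Icc (A : SL(2, ℤ)) (n : ℤ) (e : (Fin 2 → ℝ) × ℝ)
    (he : e.2 ∈ Set.Icc (n : ℝ) (n + 1)) :
    bundleCover A e = MappingTorus.mk _ (torusProj (realMulVec (A ^ (-n)) e.1),
      Set.projIcc 0 1 zero_le_one (e.2 - n)) := by
  rcases he.2.eq_or_lt with h | h
  · have hfl : ⌊e.2⌋ = n + 1 := by rw [h]; simp
    have h0 : unitFract e.2 = 0 :=
      Subtype.ext (by rw [h]; simp [unitFract])
    have h1 : Set.projIcc (0 : ℝ) 1 zero_le_one (e.2 - n) = 1 :=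
      Set.projIcc_of_right_le _ (by rw [h]; simp)
    rw [bundleCover, h0, h1, MappingTorus.mk_zero, hfl]
    congr 2
    rw [torusHomeomorph_apply, torusMap_torusProj, ← realMulVec_mul]
    congr 2
    group
  · have hfl : ⌊e.2⌋ = n := Int.floor_eq_iff.2 ⟨he.1, h⟩
    have h1 : unitFract e.2 =
        Set.projIcc (0 : ℝ) 1 zero_le_one (e.2 - n) := by
      rw [Set.projIcc_of_mem _ ⟨sub_nonneg.2 he.1, by linarith⟩]
      exact Subtype.ext (show e.2 - (⌊e.2⌋ : ℝ) = e.2 - n by rw [hfl])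
    rw [bundleCover, h1, hfl]

theorem continuous_bundleCover (A : SL(2, ℤ)) : Continuous (bundleCover A) := by
  -- Continuity is pasted from the closed slabs, a locally finite cover.
  have hlf : LocallyFinite fun n : ℤ => Set.Icc (n : ℝ) (n + 1) :=
    locallyFinite_Icc_of_tendsto tendsto_intCast_atTop_atTop
      (Filter.tendsto_atBot_add_const_right _ _ (tendsto_intCast_atBot_iff.2 Filter.tendsto_id))
  refine (hlf.preimage_continuous continuous_snd).continuous ?_
    (fun n => isClosed_Icc.preimage continuous_snd) fun n => ?_
  · refine Set.eq_univ_of_forall fun e => Set.mem_iUnion.2 ⟨⌊e.2⌋, Int.floor_le _, ?_⟩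
    exact (Int.lt_floor_add_one _).le
  · refine ContinuousOn.congr (Continuous.continuousOn ?_) fun e he =>
      bundleCover_eq_of_mem_Icc A n e he
    refine (MappingTorus.isQuotientMap_mk _).continuous.comp (.prodMk ?_ ?_)
    · exact continuous_torusProj.comp ((continuous_realMulVec _).comp continuous_fst)
    · exact continuous_projIcc.comp (by fun_prop)

/-- Already the restriction to `ℝ² × [0, 1]` is a quotient map. Openness of `torusProj` matters,
since products of mere quotient maps can fail to be quotient maps. -/
theorem isQuotientMap_bundleCover (A : SL(2, ℤ)) : IsQuotientMap (bundleCover A) := by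
  let ι : (Fin 2 → ℝ) × unitInterval → (Fin 2 → ℝ) × ℝ := Prod.map id Subtype.val
  have hι : Continuous ι := by fun_prop
  refine IsQuotientMap.of_comp hι (continuous_bundleCover A) ?_
  have : bundleCover A ∘ ι = MappingTorus.mk _ ∘ Prod.map torusProj id := by
    funext ⟨v, t⟩
    rw [Function.comp_apply, bundleCover_eq_of_mem_Icc A 0 _ (by simp [ι])]
    simp [ι]
  rw [this]
  exact (MappingTorus.isQuotientMap_mk _).comp
    (isOpenQuotientMap_torusProj.prodMap IsOpenQuotientMap.id).isQuotientMap

theorem bundleCover_eq_iff (A : SL(2, ℤ)) (e e' : (Fin 2 → ℝ) × ℝ) :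
    bundleCover A e = bundleCover A e' ↔ Int.fract e.2 = Int.fract e'.2 ∧
      torusProj (realMulVec (A ^ (-⌊e.2⌋)) e.1) = torusProj (realMulVec (A ^ (-⌊e'.2⌋)) e'.1) := by
  rw [bundleCover, bundleCover, (MappingTorus.mk_injOn _).eq_iff (unitFract_ne_one _)
    (unitFract_ne_one _), Prod.mk.injEq, unitFract_inj, and_comm]

/-! ### The deck group action -/

namespace BundleGroup

variable {A : SL(2, ℤ)}

instance : MulAction (BundleGroup A) ((Fin 2 → ℝ) × ℝ) where
  smul g e := ((fun i => (g.vec i : ℝ)) + realMulVec (A ^ g.shift) e.1, g.shift + e.2)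
  one_smul e := by
    change ((fun i => ((0 : ℤ) : ℝ)) + realMulVec (A ^ (0 : ℤ)) e.1, ((0 : ℤ) : ℝ) + e.2) = e
    ext <;> simp
  mul_smul g h e := by
    change ((fun i => ((g.vec + (A ^ g.shift).1.mulVec h.vec) i : ℝ)) +
        realMulVec (A ^ (g.shift + h.shift)) e.1, ((g.shift + h.shift : ℤ) : ℝ) + e.2) =
      ((fun i => (g.vec i : ℝ)) + realMulVec (A ^ g.shift)
        ((fun i => (h.vec i : ℝ)) + realMulVec (A ^ h.shift) e.1), (g.shift + (h.shift + e.2)))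
    rw [realMulVec_add, realMulVec_intCast, zpow_add, realMulVec_mul]
    ext i
    · simp [add_assoc]
    · simp [add_assoc]

theorem smul_def (g : BundleGroup A) (e : (Fin 2 → ℝ) × ℝ) :
    g • e = ((fun i => (g.vec i : ℝ)) + realMulVec (A ^ g.shift) e.1, g.shift + e.2) := rfl

instance : ContinuousConstSMul (BundleGroup A) ((Fin 2 → ℝ) × ℝ) where
  continuous_const_smul g := by
    simp only [smul_def]
    exact (continuous_const.add ((continuous_realMulVec _).comp continuous_fst)).prodMk
      (continuous_const.add continuous_snd)

/-- Balls of radius `1/2` in `ℝ² × ℝ` are disjoint from their translates. -/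
theorem eq_one_of_smul_mem_ball {g : BundleGroup A} {e x : (Fin 2 → ℝ) × ℝ}
    (hx : x ∈ Metric.ball e (1 / 2)) (hgx : g • x ∈ Metric.ball e (1 / 2)) : g = 1 := by
  have key {z : ℤ} (h : |(z : ℝ)| < 1) : z = 0 := Int.abs_lt_one_iff.1 (by exact_mod_cast h)
  have hd : dist (g • x) x < 1 :=
    (dist_triangle_right _ _ e).trans_lt (by rw [Metric.mem_ball] at hx hgx; linarith)
  rw [Prod.dist_eq, max_lt_iff, dist_pi_lt_iff one_pos, smul_def] at hd
  obtain ⟨h1, h2⟩ := hd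
  -- Once the shift vanishes, `g` is translation by an integer vector of sup norm below one.
  have hs : g.shift = 0 := key (by simpa [Real.dist_eq] using h2)
  ext i
  · exact key (by simpa [Real.dist_eq, hs] using h1 i)
  · exact hs

end BundleGroup

theorem bundleCover_eq_iff_mem_orbit (A : SL(2, ℤ)) {e e' : (Fin 2 → ℝ) × ℝ} :
    bundleCover A e = bundleCover A e' ↔ e ∈ MulAction.orbit (BundleGroup A) e' := by
  rw [bundleCover_eq_iff, Int.fract_eq_fract, torusProj_eq_iff]
  constructor
  · rintro ⟨⟨n, hn⟩, z, hz⟩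
    have hfl : ⌊e.2⌋ = n + ⌊e'.2⌋ := by
      rw [sub_eq_iff_eq_add.1 hn, Int.floor_intCast_add]
    -- Undoing the twist on `e` turns the lattice vector `z` into the translation part of the deck
    -- transformation.
    have := congrArg (realMulVec (A ^ ⌊e.2⌋)) hz
    rw [realMulVec_add, ← realMulVec_mul, ← realMulVec_mul, ← zpow_add, ← zpow_add,
      realMulVec_intCast, add_neg_cancel, zpow_zero, realMulVec_one] at this
    refine ⟨⟨(A ^ ⌊e.2⌋).1.mulVec z, n⟩, Prod.ext (Eq.trans ?_ this.symm) ?_⟩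
    · rw [hfl, add_neg_cancel_right]
      rfl
    · exact (sub_eq_iff_eq_add.1 hn).symm
  · rintro ⟨g, rfl⟩
    simp only [BundleGroup.smul_def]
    refine ⟨⟨g.shift, by simp⟩, (A ^ (-⌊g.shift + e'.2⌋)).1.mulVec g.vec, ?_⟩
    rw [realMulVec_add, realMulVec_intCast, ← realMulVec_mul, ← zpow_add, Int.floor_intCast_add]
    simp

theorem isQuotientCoveringMap_bundleCover (A : SL(2, ℤ)) :
    IsQuotientCoveringMap (bundleCover A) (BundleGroup A) where
  toIsQuotientMap := isQuotientMap_bundleCover A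
  toContinuousConstSMul := inferInstance
  apply_eq_iff_mem_orbit := bundleCover_eq_iff_mem_orbit A
  disjoint e := by
    refine ⟨Metric.ball e (1 / 2), Metric.ball_mem_nhds e one_half_pos, ?_⟩
    rintro g ⟨_, ⟨x, hx, rfl⟩, hgx⟩
    exact BundleGroup.eq_one_of_smul_mem_ball hx hgx

/-! ### The fundamental group and the invariant -/

/-- The fundamental group of the torus bundle `M(A)` is (anti-)isomorphic to `ℤ² ⋊ ℤ`. -/
def fundamentalGroupTorusBundle (A : SL(2, ℤ)) (x₀ : torusBundle A) :
    FundamentalGroup (torusBundle A) x₀ ≃* (BundleGroup A)ᵐᵒᵖ :=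
  (isQuotientCoveringMap_bundleCover A).fundamentalGroupEquiv
    ⟨_, ((isQuotientCoveringMap_bundleCover A).surjective x₀).choose_spec⟩

/-- Homomorphisms from the opposite of a group to a commutative group. -/
def homMulOppositeEquiv (G H : Type*) [Group G] [CommGroup H] : (Gᵐᵒᵖ →* H) ≃ (G →* H) where
  toFun f := ⟨⟨fun g => f (.op g), map_one f⟩, fun a b => by
    rw [mul_comm, ← map_mul]; rfl⟩
  invFun f := ⟨⟨fun g => f g.unop, map_one f⟩, fun a b => by
    rw [mul_comm, ← map_mul]; rfl⟩
  left_inv _ := rfl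
  right_inv _ := rfl

theorem untwistedInvariant_torusBundle (A : SL(2, ℤ)) (x₀ : torusBundle A) :
    untwistedInvariant (torusBundle A) x₀ (Multiplicative (ZMod 2)) =
      Nat.card {u : Fin 2 → ZMod 2 // Matrix.vecMul u (reduction A).1 = u} := by
  rw [untwistedInvariant,
    Nat.card_congr ((fundamentalGroupTorusBundle A x₀).monoidHomCongrLeftEquiv.trans (homMulOppositeEquiv _ _)),
    BundleGroup.card_hom]
  simp

end DijkgraafWitten

end

theorem mainTheorem6 (c : ConjClasses SL(2, ℤ)) (A : SL(2, ℤ)) (hA : A ∈ c.carrier)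
    (x₀ : DijkgraafWitten.torusBundle A) :
    ((ConjClasses.map DijkgraafWitten.reduction c).carrier = DijkgraafWitten.classC1 →
      DijkgraafWitten.untwistedInvariant (DijkgraafWitten.torusBundle A) x₀
        (Multiplicative (ZMod 2)) = 4) ∧
    ((ConjClasses.map DijkgraafWitten.reduction c).carrier = DijkgraafWitten.classC2 →
      DijkgraafWitten.untwistedInvariant (DijkgraafWitten.torusBundle A) x₀
        (Multiplicative (ZMod 2)) = 2) ∧
    ((ConjClasses.map DijkgraafWitten.reduction c).carrier ≠ DijkgraafWitten.classC1 →
      (ConjClasses.map DijkgraafWitten.reduction c).carrier ≠ DijkgraafWitten.classC2 →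
      DijkgraafWitten.untwistedInvariant (DijkgraafWitten.torusBundle A) x₀
        (Multiplicative (ZMod 2)) = 1) := by
  have hB : DijkgraafWitten.reduction A ∈ (ConjClasses.map DijkgraafWitten.reduction c).carrier := by
    rw [ConjClasses.mem_carrier_iff_mk_eq] at hA ⊢
    rw [← hA]
    rfl
  rw [Ne, Ne, DijkgraafWitten.classC1_eq_carrier, DijkgraafWitten.classC2_eq_carrier,
    DijkgraafWitten.carrier_eq_iff_mem hB, DijkgraafWitten.carrier_eq_iff_mem hB,
    ← DijkgraafWitten.classC1_eq_carrier, ← DijkgraafWitten.classC2_eq_carrier,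
    DijkgraafWitten.untwistedInvariant_torusBundle]
  exact_mod_cast DijkgraafWitten.card_fixed_vecMul (DijkgraafWitten.reduction A)
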